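/- A group $G$ is a \emph{commutator-relators group} if it admits a presentation $G=F(n)/R$, where $F(n)$ is the free group on $n$ generators ($n\ge 0$ an integer) and $R$ is the normal closure of a finite subset of the commutator subgroup $[F(n),F(n)]$. Let $G_1=G$, $G_{q+1}=[G,G_q]$ be the lower central series of $G$, let $p$ be a prime, write $\mathbb{Z}_p$ for the field with $p$ elements, and let $d\ge 0$ be an integer. Let $\nu_{p,d}(G/G_3)$ be the number of normal subgroups $K$ of $G/G_3$ of index $p$ such that $$\dim_{\mathbb{Z}_p}\big(\operatorname{Tors}H_1(K)\otimes\mathbb{Z}_p\big)=d,$$ where $H_1(K)$ is the abelianization of $K$ and $\operatorname{Tors}$ denotes the torsion subgroup. Let $\mathcal{R}_d(G,\mathbb{Z}_p)$ be the set of all $\lambda\in H^1(G,\mathbb{Z}_p)$ for which there is a linear subspace $W\subseteq H^1(G,\mathbb{Z}_p)$ with $\dim W=d+1$ and $\lambda\cup w=0$ in $H^2(G,\mathbb{Z}_p)$ for all $w\in W$ (group cohomology with trivial coefficients). This set is closed under scalar multiplication; let $\mathcal{P}_d(G,\mathbb{Z}_p)\subseteq\mathbb{P}(H^1(G,\mathbb{Z}_p))$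 be its projectivization, that is, the set of lines spanned by nonzero elements of $\mathcal{R}_d(G,\mathbb{Z}_p)$. \textbf{Theorem.} Let $G$ be a commutator-relators group such that $H_2(G)=H_2(G,\mathbb{Z})$ is torsion-free. Then, for every prime $p$ and every integer $d\ge 0$, both of the following counts are finite, and $$\nu_{p,d}(G/G_3)=\#\big(\mathcal{P}_d(G,\mathbb{Z}_p)\setminus\mathcal{P}_{d+1}(G,\mathbb{Z}_p)\big).$$ -/

import Mathlib

universe u

open CategoryTheory

noncomputable section

/-- `G` is a commutator-relators group: it has a presentation `G = F(n)/R`, where `F(n)` is the free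
group on `n` generators and `R` is the normal closure of a finite subset of `[F(n), F(n)]`. -/
def IsCommutatorRelators (G : Type*) [Group G] : Prop :=
  ∃ (n : ℕ) (rels : Set (FreeGroup (Fin n))),
    rels.Finite ∧ rels ⊆ (commutator (FreeGroup (Fin n)) : Set (FreeGroup (Fin n))) ∧
      Nonempty (G ≃* PresentedGroup rels)

/-- The integral homology group `H_i(G) = H_i(G, ℤ)`, with trivial action on `ℤ` (lifted to the
universe of `G`). -/
abbrev IntegralHomology (G : Type u) [Group G] (i : ℕ) : Type u :=
  groupHomology (Rep.trivial (ULift.{u} ℤ) G (ULift.{u} ℤ)) i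

/-- The second nilpotent quotient `G/G_3`, where `G_3 = [[G, G], G]`
(the terms of Mathlib's lower central series are numbered from `0`). -/
abbrev SecondNilpotentQuotient (G : Type*) [Group G] : Type _ :=
  G ⧸ (⊤ : Subgroup G).lowerCentralSeries 2

/-- The set of the normal subgroups `K` of `N` with `[N : K] = p` and
`dim_{ℤ/p} (Tors H_1(K)) ⊗ ℤ/p = d`, where `H_1(K)` is the abelianization of `K`. -/
def nuSet (N : Type*) [Group N] (p d : ℕ) : Set (Subgroup N) :=
  {K | K.Normal ∧ K.index = p ∧
    Module.rank (ZMod p)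
      (TensorProduct ℤ (ZMod p) (Submodule.torsion ℤ (Additive (Abelianization K)))) = d}

/-- The invariant `ν_{p,d}(N)`. -/
def nu (N : Type*) [Group N] (p d : ℕ) : ℕ := (nuSet N p d).ncard

section Cohomology

variable (G : Type u) [Group G] (𝕜 : Type u) [Field 𝕜]

/-- The cohomology group `H^i(G, 𝕜)`, with trivial action on `𝕜`. -/
abbrev Cohomology (i : ℕ) : Type u := groupCohomology (Rep.trivial 𝕜 G 𝕜) i

variable {G 𝕜}

/-- The cup product of two 1-cocycles: `(f ∪ g)(x, y) = f(x) g(y)`. -/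
def cupCocycle (f g : groupCohomology.cocycles₁ (Rep.trivial 𝕜 G 𝕜)) :
    groupCohomology.cocycles₂ (Rep.trivial 𝕜 G 𝕜) :=
  ⟨fun x => (show 𝕜 from f x.1) * (show 𝕜 from g x.2), by
    rw [groupCohomology.mem_cocycles₂_iff]
    intro x y z
    rw [groupCohomology.cocycles₁_map_mul_of_isTrivial f x y,
      groupCohomology.cocycles₁_map_mul_of_isTrivial g y z]
    change ((f x : 𝕜) + f y) * g z + f x * g y = f y * g z + f x * (g y + g z)
    ring⟩

variable (G 𝕜)

/-- The cup product of 1-cocycles, with values in `H^2(G, 𝕜)`, as a bilinear map. -/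
def cupOnCocycles : groupCohomology.cocycles₁ (Rep.trivial 𝕜 G 𝕜) →ₗ[𝕜]
    groupCohomology.cocycles₁ (Rep.trivial 𝕜 G 𝕜) →ₗ[𝕜] Cohomology G 𝕜 2 :=
  LinearMap.mk₂ 𝕜 (fun f g => (groupCohomology.H2π (Rep.trivial 𝕜 G 𝕜)).hom (cupCocycle f g))
    (fun f f' g => by
      rw [← map_add]; congr 1; ext x y
      exact add_mul (f x : 𝕜) (f' x : 𝕜) (g y : 𝕜))
    (fun c f g => by
      rw [← map_smul]; congr 1; ext x y
      exact mul_assoc c (f x : 𝕜) (g y : 𝕜))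
    (fun f g g' => by
      rw [← map_add]; congr 1; ext x y
      exact mul_add (f x : 𝕜) (g y : 𝕜) (g' y : 𝕜))
    (fun c f g => by
      rw [← map_smul]; congr 1; ext x y
      exact mul_left_comm (f x : 𝕜) c (g y : 𝕜))

/-- For trivial coefficients every 1-coboundary is zero, so a class in `H^1(G, 𝕜)` is the same thing
as a 1-cocycle; this is the inverse of the projection `H1π` from cocycles to classes. -/
def h1ToCocycles : Cohomology G 𝕜 1 →ₗ[𝕜] groupCohomology.cocycles₁ (Rep.trivial 𝕜 G 𝕜) :=
  (groupCohomology.H1IsoOfIsTrivial (Rep.trivial 𝕜 G 𝕜) ≪≫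
    (groupCohomology.cocycles₁IsoOfIsTrivial (Rep.trivial 𝕜 G 𝕜)).symm).hom.hom

/-- The cup product `H^1(G, 𝕜) × H^1(G, 𝕜) → H^2(G, 𝕜)`. -/
def cupProduct : Cohomology G 𝕜 1 →ₗ[𝕜] Cohomology G 𝕜 1 →ₗ[𝕜] Cohomology G 𝕜 2 :=
  (cupOnCocycles G 𝕜).compl₁₂ (h1ToCocycles G 𝕜) (h1ToCocycles G 𝕜)

theorem h1ToCocycles_H1π (f : groupCohomology.cocycles₁ (Rep.trivial 𝕜 G 𝕜)) :
    h1ToCocycles G 𝕜 ((groupCohomology.H1π (Rep.trivial 𝕜 G 𝕜)).hom f) = f := by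
  have h := groupCohomology.H1π_comp_H1IsoOfIsTrivial_hom (Rep.trivial 𝕜 G 𝕜)
  have h' : groupCohomology.H1π (Rep.trivial 𝕜 G 𝕜) ≫
      (groupCohomology.H1IsoOfIsTrivial (Rep.trivial 𝕜 G 𝕜) ≪≫
        (groupCohomology.cocycles₁IsoOfIsTrivial (Rep.trivial 𝕜 G 𝕜)).symm).hom = 𝟙 _ := by
    rw [Iso.trans_hom, ← Category.assoc, h]
    simp
  exact congrArg (fun φ => φ.hom f) h'

/-- The cup product of classes is computed on representing cocycles. -/
theorem cupProduct_H1π (f g : groupCohomology.cocycles₁ (Rep.trivial 𝕜 G 𝕜)) :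
    cupProduct G 𝕜 ((groupCohomology.H1π (Rep.trivial 𝕜 G 𝕜)).hom f)
      ((groupCohomology.H1π (Rep.trivial 𝕜 G 𝕜)).hom g) =
      (groupCohomology.H2π (Rep.trivial 𝕜 G 𝕜)).hom (cupCocycle f g) := by
  exact congrArg₂ (fun a b => cupOnCocycles G 𝕜 a b) (h1ToCocycles_H1π G 𝕜 f)
    (h1ToCocycles_H1π G 𝕜 g)

/-- The `d`-th resonance variety `R_d(G, 𝕜)`: the classes `l ∈ H^1(G, 𝕜)` for which there is a
subspace `W ⊆ H^1(G, 𝕜)` of dimension `d + 1` with `l ∪ w = 0` for all `w ∈ W`. -/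
def resonanceVariety (d : ℕ) : Set (Cohomology G 𝕜 1) :=
  {l | ∃ W : Submodule 𝕜 (Cohomology G 𝕜 1),
    Module.finrank 𝕜 W = d + 1 ∧ ∀ w ∈ W, cupProduct G 𝕜 l w = 0}

/-- The projectivization `P_d(G, 𝕜)` of `R_d(G, 𝕜)`: the points of `ℙ(H^1(G, 𝕜))` that are spanned by
a nonzero element of `R_d(G, 𝕜)`. -/
def projResonanceVariety (d : ℕ) : Set (Projectivization 𝕜 (Cohomology G 𝕜 1)) :=
  {x | ∃ (l : Cohomology G 𝕜 1) (hl : l ≠ 0),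
    Projectivization.mk 𝕜 l hl = x ∧ l ∈ resonanceVariety G 𝕜 d}

/-- Resonance varieties are homogeneous: membership in `P_d(G, 𝕜)` may be tested on any spanning
vector. -/
theorem mk_mem_projResonanceVariety (d : ℕ) (l : Cohomology G 𝕜 1) (hl : l ≠ 0) :
    Projectivization.mk 𝕜 l hl ∈ projResonanceVariety G 𝕜 d ↔ l ∈ resonanceVariety G 𝕜 d := by
  constructor
  · rintro ⟨l', hl', h, W, hW, hW0⟩
    obtain ⟨a, rfl⟩ := (Projectivization.mk_eq_mk_iff' 𝕜 _ _ hl' hl).1 h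
    have ha : a ≠ 0 := by rintro rfl; simp at hl'
    refine ⟨W, hW, fun w hw => ?_⟩
    have := hW0 w hw
    rw [map_smul, LinearMap.smul_apply] at this
    exact (smul_eq_zero.1 this).resolve_left ha
  · exact fun h => ⟨l, hl, rfl, h⟩

end Cohomology

end

/-!
Write `N = G/G_3`, and let `l` be a nonzero homomorphism from `N` to `𝔽 = 𝔽_p`. A class in
`H^1(G, 𝔽)` is the same thing as a homomorphism from `N` to `𝔽`, and a subgroup of index `p` of `N`
that is normal is the same thing as the kernel `K` of some `l`, which is determined up to a scalar.
So it suffices to compare, for a fixed `l`, the torsion of `H_1(K)` with the space of all `m` such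
that `l ∪ m = 0`.

*Cup products.* A cochain `c` on `G` with coboundary `l ∪ m` restricts, up to sign, to a
homomorphism on `[G, G]` that sends `[x, y]` to `l x * m y - l y * m x`, and `c` descends to `N`.
Conversely, every cup product bounds a cochain on the free group `F`, because a homomorphism to the
Heisenberg group can be prescribed on generators. If the alternating form `l ∧ m` extends to a
homomorphism on `[N, N]`, then this cochain vanishes on the relators, which lie in `[F, F]`, and it
descends to `G`. Hence `l ∪ m = 0` in `H^2(G, 𝔽)` if and only if `l ∧ m` extends to `[N, N]`
(`exists_boundsCup_inflate_iff`).

*Torsion.* The abelianization of `N` is free abelian and `N/K` is finite, so the torsion of `H_1(K)`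
is exactly the image of `[N, N]`, that is, `[N, N]/[K, K]`
(`commutatorToH1_mem_torsion`, `commutatorToTorsion_surjective`). A homomorphism `ψ` from it to `𝔽`
is an alternating form on `N` vanishing on `K × K`, hence of the form `l ∧ m`, and `m` is determined
by `ψ` up to a multiple of `l`. So the space of the `m` with `l ∪ m = 0` has dimension one more
than `Hom(Tors H_1(K), 𝔽)` (`card_wedgeExtends`), which is the dual of `Tors H_1(K) ⊗ ℤ/p`.
-/

open scoped commutatorElement

noncomputable section

/-! ### Cup products of degree-one classes and two-step nilpotent quotients -/

/-- The cochain `c : Γ → 𝕜` bounds the cup product of the homomorphisms `l` and `m`, that is,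
`(x, y) ↦ l x * m y` is the coboundary of `c` (trivial coefficients). Equivalently, `l`, `m` and
`-c` are the three entries of a homomorphism from `Γ` to the Heisenberg group over `𝕜`. -/
def BoundsCup {Γ 𝕜 : Type*} [Group Γ] [CommRing 𝕜] (l m : Additive Γ →+ 𝕜) (c : Γ → 𝕜) : Prop :=
  ∀ x y, c (x * y) = c x + c y - l (.ofMul x) * m (.ofMul y)

/-- The commutator of two elements, as an element of the additively written commutator subgroup. -/
def commElt {N : Type*} [Group N] (x y : N) : Additive (commutator N) :=
  .ofMul ⟨⁅x, y⁆, Subgroup.commutator_mem_commutator (Subgroup.mem_top x) (Subgroup.mem_top y)⟩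

/-- The alternating form `l ∧ m : (x, y) ↦ l x * m y - l y * m x` extends to the commutator
subgroup: some homomorphism on `[N, N]` takes the value `(l ∧ m) (x, y)` at `[x, y]`. -/
def WedgeExtends {N 𝕜 : Type*} [Group N] [CommRing 𝕜] (l m : Additive N →+ 𝕜) : Prop :=
  ∃ φ : Additive (commutator N) →+ 𝕜, ∀ x y,
    φ (commElt x y) = l (.ofMul x) * m (.ofMul y) - l (.ofMul y) * m (.ofMul x)

section

variable {Γ 𝕜 : Type*} [Group Γ] [CommRing 𝕜]

theorem addHom_eq_zero_of_mem_commutator (l : Additive Γ →+ 𝕜) {x : Γ} (hx : x ∈ commutator Γ) :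
    l (.ofMul x) = 0 :=
  Abelianization.commutator_subset_ker (AddMonoidHom.toMultiplicativeRight l) hx

theorem lowerCentralSeries_two_le_commutator (G : Type*) [Group G] :
    (⊤ : Subgroup G).lowerCentralSeries 2 ≤ commutator G := by
  rw [← Subgroup.top_lowerCentralSeries_one]
  exact Subgroup.lowerCentralSeries_antitone _ one_le_two

namespace BoundsCup

variable {l m : Additive Γ →+ 𝕜} {c : Γ → 𝕜}

theorem map_one (h : BoundsCup l m c) : c 1 = 0 := by
  have := h 1 1
  simpa using this

theorem map_mul_of_mem (h : BoundsCup l m c) {x : Γ} (hx : x ∈ commutator Γ) (y : Γ) :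
    c (x * y) = c x + c y := by
  rw [h, addHom_eq_zero_of_mem_commutator l hx, zero_mul, sub_zero]

theorem map_mul_of_mem_right (h : BoundsCup l m c) {y : Γ} (hy : y ∈ commutator Γ) (x : Γ) :
    c (x * y) = c x + c y := by
  rw [h, addHom_eq_zero_of_mem_commutator m hy, mul_zero, sub_zero]

theorem map_commutatorElement (h : BoundsCup l m c) (x y : Γ) :
    c ⁅x, y⁆ = -(l (.ofMul x) * m (.ofMul y) - l (.ofMul y) * m (.ofMul x)) := by
  have h1 := h.map_mul_of_mem
    (Subgroup.commutator_mem_commutator (Subgroup.mem_top x) (Subgroup.mem_top y)) (y * x)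
  have h2 : ⁅x, y⁆ * (y * x) = x * y := by simp [commutatorElement_def, mul_assoc]
  rw [h2, h x y, h y x] at h1
  linear_combination -h1

/-- Up to sign, a cochain bounding `l ∪ m` restricts to an extension of `l ∧ m` to the commutator
subgroup. -/
theorem wedgeExtends (h : BoundsCup l m c) : WedgeExtends l m :=
  ⟨{ toFun := fun z => -c z.toMul.1
     map_zero' := by simpa using h.map_one
     map_add' := fun x y => by
      have := h.map_mul_of_mem x.toMul.2 y.toMul.1
      simp only [toMul_add, Subgroup.coe_mul, this, neg_add] }, fun x y => by
    have := h.map_commutatorElement x y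
    simp [commElt, this]⟩

theorem eq_zero_of_mem_lowerCentralSeries_two (h : BoundsCup l m c) {x : Γ}
    (hx : x ∈ (⊤ : Subgroup Γ).lowerCentralSeries 2) : c x = 0 := by
  let S : Subgroup Γ :=
    { carrier := {g | g ∈ commutator Γ ∧ c g = 0}
      one_mem' := ⟨one_mem _, h.map_one⟩
      mul_mem' := fun {a b} ha hb => ⟨mul_mem ha.1 hb.1, by
        rw [h.map_mul_of_mem ha.1, ha.2, hb.2, add_zero]⟩
      inv_mem' := fun {a} ha => ⟨inv_mem ha.1, by
        have := h.map_mul_of_mem ha.1 a⁻¹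
        rwa [mul_inv_cancel, h.map_one, ha.2, zero_add, eq_comm] at this⟩ }
  have : (⊤ : Subgroup Γ).lowerCentralSeries 2 ≤ S := by
    rw [Subgroup.lowerCentralSeries_succ, Subgroup.top_lowerCentralSeries_one,
      Subgroup.commutator_le]
    refine fun a ha b _ => ⟨Subgroup.commutator_mem_commutator trivial trivial, ?_⟩
    rw [h.map_commutatorElement, addHom_eq_zero_of_mem_commutator l ha,
      addHom_eq_zero_of_mem_commutator m ha]
    simp
  exact (this hx).2

end BoundsCup

/-- Over a free group every cup product of degree-one classes vanishes: a homomorphism to the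
Heisenberg group may be prescribed on the generators. -/
theorem exists_boundsCup_freeGroup {α : Type*} (l m : Additive (FreeGroup α) →+ 𝕜) :
    ∃ c, BoundsCup l m c := by
  -- The Heisenberg group acts on `𝕜 × 𝕜` by these permutations.
  let P (a b c : 𝕜) : Equiv.Perm (𝕜 × 𝕜) :=
    { toFun := fun v => (v.1 - a * v.2 + c, v.2 + b)
      invFun := fun v => (v.1 + a * (v.2 - b) - c, v.2 - b)
      left_inv := fun v => by ext <;> simp [sub_eq_add_neg, add_assoc]
      right_inv := fun v => by ext <;> simp [sub_eq_add_neg, add_assoc] }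
  have hPmul (a b c a' b' c' : 𝕜) :
      P a b c * P a' b' c' = P (a + a') (b + b') (c + c' - a * b') := by
    ext v <;> simp [P] <;> ring
  have hPinv (a b c : 𝕜) : (P a b c)⁻¹ = P (-a) (-b) (-c - a * b) := by
    rw [inv_eq_iff_mul_eq_one, hPmul]
    ext v <;> simp [P, sub_eq_add_neg, add_assoc]
  let ρ : FreeGroup α →* Equiv.Perm (𝕜 × 𝕜) :=
    FreeGroup.lift fun i => P (l (.ofMul (.of i))) (m (.ofMul (.of i))) 0
  have key (x : FreeGroup α) : ∃ c, ρ x = P (l (.ofMul x)) (m (.ofMul x)) c := by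
    induction x using FreeGroup.induction_on with
    | C1 =>
      refine ⟨0, ?_⟩
      ext v <;> simp [P]
    | of i => exact ⟨0, by simp [ρ]⟩
    | inv_of i ih =>
      obtain ⟨c, hc⟩ := ih
      exact ⟨_, by rw [_root_.map_inv, hc, hPinv, ofMul_inv, map_neg, map_neg]⟩
    | mul x y hx hy =>
      obtain ⟨c, hc⟩ := hx
      obtain ⟨c', hc'⟩ := hy
      exact ⟨_, by rw [map_mul, hc, hc', hPmul, ofMul_mul, map_add, map_add]⟩
  choose c hc using key
  refine ⟨c, fun x y => ?_⟩
  have h := map_mul ρ x y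
  rw [hc, hc, hc, hPmul] at h
  simpa [P] using congrArg (fun σ : Equiv.Perm (𝕜 × 𝕜) => (σ (0, 0)).1) h

end

section

variable {α G 𝕜 : Type*} [Group G] [CommRing 𝕜]

/-- The homomorphism on `G` obtained from one on `G/G_3`. -/
def inflate (l : Additive (SecondNilpotentQuotient G) →+ 𝕜) : Additive G →+ 𝕜 :=
  l.comp (QuotientGroup.mk' ((⊤ : Subgroup G).lowerCentralSeries 2)).toAdditive

/-- Over a group with a presentation `π` all of whose relators are products of commutators, the
vanishing of `l ∪ m` can be read off in `G/G_3`. For the converse direction, a cochain bounding the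
cup product on the free group is, on commutators, the negative of the given extension `φ` of
`l ∧ m`; so it vanishes on the relators and descends to `G`. -/
theorem exists_boundsCup_inflate_iff (π : FreeGroup α →* G) (hπ : Function.Surjective π)
    (hker : π.ker ≤ commutator (FreeGroup α))
    (l m : Additive (SecondNilpotentQuotient G) →+ 𝕜) :
    (∃ c, BoundsCup (inflate l) (inflate m) c) ↔ WedgeExtends l m := by
  constructor
  · rintro ⟨c, hc⟩
    have hdesc (a b : G) 
        (hab : QuotientGroup.leftRel ((⊤ : Subgroup G).lowerCentralSeries 2) a b) : c a = c b := by
      rw [QuotientGroup.leftRel_apply] at hab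
      have := hc.map_mul_of_mem_right (lowerCentralSeries_two_le_commutator G hab) a
      rw [mul_inv_cancel_left, hc.eq_zero_of_mem_lowerCentralSeries_two hab, add_zero] at this
      exact this.symm
    refine BoundsCup.wedgeExtends (c := Quotient.lift c hdesc) ?_
    intro x y
    induction x using QuotientGroup.induction_on with | _ x
    induction y using QuotientGroup.induction_on with | _ y
    exact hc x y
  · rintro ⟨φ, hφ⟩
    obtain ⟨c, hc⟩ := exists_boundsCup_freeGroup
      ((inflate l).comp π.toAdditive) ((inflate m).comp π.toAdditive)
    let q : FreeGroup α →* SecondNilpotentQuotient G := (QuotientGroup.mk' _).comp π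
    -- The elements of `[F, F]` on which `c` is the negative of the pull-back of `φ`.
    let S : Subgroup (FreeGroup α) :=
      { carrier := {g | g ∈ commutator (FreeGroup α) ∧
          ∃ h : q g ∈ commutator (SecondNilpotentQuotient G), c g = -φ (.ofMul ⟨q g, h⟩)}
        one_mem' := ⟨one_mem _, by rw [map_one]; exact one_mem _, by
          rw [hc.map_one, eq_comm, neg_eq_zero, ← map_zero φ]
          congr 2
          exact Subtype.ext (map_one q)⟩
        mul_mem' := by
          rintro a b ⟨ha, ha', hac⟩ ⟨hb, hb', hbc⟩
          refine ⟨mul_mem ha hb, by rw [map_mul]; exact mul_mem ha' hb', ?_⟩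
          rw [hc.map_mul_of_mem ha, hac, hbc, ← neg_add, ← map_add]
          congr 3
          exact Subtype.ext (map_mul q a b).symm
        inv_mem' := by
          rintro a ⟨ha, ha', hac⟩
          refine ⟨inv_mem ha, by rw [map_inv]; exact inv_mem ha', ?_⟩
          have := hc.map_mul_of_mem ha a⁻¹
          rw [mul_inv_cancel, hc.map_one, hac, eq_comm, neg_add_eq_zero] at this
          rw [← this, ← map_neg]
          refine congrArg φ ?_
          rw [← ofMul_inv]
          exact congrArg Additive.ofMul (Subtype.ext (by simp)) }
    have hS : commutator (FreeGroup α) ≤ S := by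
      rw [commutator_def, Subgroup.commutator_le]
      intro a _ b _
      have hab : q ⁅a, b⁆ = ⁅q a, q b⁆ := map_commutatorElement q a b
      refine ⟨Subgroup.commutator_mem_commutator trivial trivial, ?_, ?_⟩
      · rw [hab]
        exact Subgroup.commutator_mem_commutator trivial trivial
      · rw [hc.map_commutatorElement]
        congr 1
        refine (hφ (q a) (q b)).symm.trans ?_
        congr 2
        exact Subtype.ext hab.symm
    have hcker (r : FreeGroup α) (hr : r ∈ π.ker) : c r = 0 := by
      obtain ⟨-, h, e⟩ := hS (hker hr)
      rw [e, neg_eq_zero, ← map_zero φ]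
      congr 2
      refine Subtype.ext ?_
      change QuotientGroup.mk' _ (π r) = 1
      rw [MonoidHom.mem_ker.1 hr, map_one]
    have hceq (a b : FreeGroup α) (hab : π a = π b) : c a = c b := by
      have hr : a⁻¹ * b ∈ π.ker := by rw [MonoidHom.mem_ker, map_mul, map_inv, hab, inv_mul_cancel]
      have := hc.map_mul_of_mem_right (hker hr) a
      rw [mul_inv_cancel_left, hcker _ hr, add_zero] at this
      exact this.symm
    refine ⟨fun g => c (Function.surjInv hπ g), fun x y => ?_⟩
    dsimp only
    rw [← hceq (Function.surjInv hπ x * Function.surjInv hπ y) (Function.surjInv hπ (x * y))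
      (by simp [Function.surjInv_eq]), hc]
    congr 2
    · exact congrArg (fun g => inflate l (.ofMul g)) (Function.surjInv_eq hπ x)
    · exact congrArg (fun g => inflate m (.ofMul g)) (Function.surjInv_eq hπ y)

end

/-! ### Torsion in the homology of a normal subgroup of prime index -/

section

variable {N : Type*} [Group N]

section Commutators

theorem closure_range_commElt :
    AddSubgroup.closure (Set.range fun z : N × N => commElt z.1 z.2) = ⊤ := by
  rw [eq_top_iff]
  rintro ⟨z, hz⟩ -
  rw [commutator_def, Subgroup.commutator_def] at hz
  have hz' := hz
  revert hz'
  refine Subgroup.closure_induction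
    (p := fun z _ => ∀ h : z ∈ commutator N, (Additive.ofMul ⟨z, h⟩ : Additive (commutator N)) ∈
      AddSubgroup.closure (Set.range fun z : N × N => commElt z.1 z.2)) ?_ ?_ ?_ ?_ hz
  · rintro _ ⟨x, -, y, -, rfl⟩ h
    exact AddSubgroup.subset_closure ⟨(x, y), rfl⟩
  · intro h
    exact zero_mem _
  · intro x y hx hy ihx ihy h
    rw [← Subgroup.commutator_def, ← commutator_def] at hx hy
    exact add_mem (ihx hx) (ihy hy)
  · intro x hx ih h
    rw [← Subgroup.commutator_def, ← commutator_def] at hx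
    exact neg_mem (ih hx)

theorem addHom_ext_commElt {M : Type*} [AddMonoid M] {f g : Additive (commutator N) →+ M}
    (h : ∀ x y, f (commElt x y) = g (commElt x y)) : f = g := by
  refine AddMonoidHom.eq_of_eqOn_dense closure_range_commElt ?_
  rintro _ ⟨z, rfl⟩
  exact h _ _

theorem commElt_self (x : N) : commElt x x = 0 :=
  congrArg Additive.ofMul (Subtype.ext (commutatorElement_self x))

theorem neg_commElt (x y : N) : -commElt x y = commElt y x :=
  congrArg Additive.ofMul (Subtype.ext (commutatorElement_inv x y))

variable (hN : commutator N ≤ Subgroup.center N)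

include hN

theorem commElt_mul_left (x y z : N) : commElt (x * y) z = commElt x z + commElt y z := by
  refine congrArg Additive.ofMul (Subtype.ext ?_)
  change ⁅x * y, z⁆ = ⁅x, z⁆ * ⁅y, z⁆
  have hc (a b c : N) : a * ⁅b, c⁆ = ⁅b, c⁆ * a := Subgroup.mem_center_iff.1
    (hN (Subgroup.commutator_mem_commutator (Subgroup.mem_top b) (Subgroup.mem_top c))) a
  rw [commutatorElement_mul_left_eq_conj_mul, hc x, mul_inv_cancel_right, hc]

theorem commElt_mul_right (x y z : N) : commElt x (y * z) = commElt x y + commElt x z := by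
  rw [← neg_commElt, commElt_mul_left hN, neg_add_rev, neg_commElt, neg_commElt]
  exact congrArg Additive.ofMul (Subtype.ext ((Subgroup.mem_center_iff.1 (hN
    (Subgroup.commutator_mem_commutator (Subgroup.mem_top x) (Subgroup.mem_top y))) _)))

theorem commElt_pow_left (x y : N) (n : ℕ) : commElt (x ^ n) y = n • commElt x y := by
  induction n with
  | zero =>
    rw [pow_zero, zero_smul]
    exact congrArg Additive.ofMul (Subtype.ext (commutatorElement_one_left y))
  | succ n ih => rw [pow_succ, commElt_mul_left hN, ih, succ_nsmul]

theorem commElt_pow_right (x y : N) (n : ℕ) : commElt x (y ^ n) = n • commElt x y := by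
  rw [← neg_commElt, commElt_pow_left hN, ← neg_nsmul, neg_commElt]

end Commutators

/-- The torsion subgroup of the first homology group `H_1(K)`. -/
abbrev H1Torsion (K : Subgroup N) : Submodule ℤ (Additive (Abelianization K)) :=
  Submodule.torsion ℤ (Additive (Abelianization K))

/-- The map from `[N, N]` to `H_1(K)`, for a subgroup `K` containing `[N, N]`. -/
def commutatorToH1 {K : Subgroup N} (hK : commutator N ≤ K) :
    Additive (commutator N) →+ Additive (Abelianization K) :=
  (Abelianization.of.comp (Subgroup.inclusion hK)).toAdditive

theorem commutatorToH1_commElt {K : Subgroup N} (hK : commutator N ≤ K) {x y : N} (hx : x ∈ K)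
    (hy : y ∈ K) : commutatorToH1 hK (commElt x y) = 0 := by
  refine congrArg Additive.ofMul ((QuotientGroup.eq_one_iff _).2 ?_)
  exact Subgroup.commutator_mem_commutator (Subgroup.mem_top (⟨x, hx⟩ : K))
    (Subgroup.mem_top (⟨y, hy⟩ : K))

/-- If `N` has class two and `N/K` has exponent dividing `p`, then `[N, N]` maps to torsion classes
of `H_1(K)`: indeed `p ^ 2 • [x, y] = [x ^ p, y ^ p]`. -/
theorem commutatorToH1_mem_torsion (hN : commutator N ≤ Subgroup.center N) {K : Subgroup N}
    (hK : commutator N ≤ K) {p : ℕ} (hp : p ≠ 0) (hpow : ∀ x : N, x ^ p ∈ K)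
    (a : Additive (commutator N)) : commutatorToH1 hK a ∈ H1Torsion K := by
  have ha : a ∈ AddSubgroup.closure (Set.range fun z : N × N => commElt z.1 z.2) := by
    rw [closure_range_commElt]; trivial
  induction ha using AddSubgroup.closure_induction with
  | mem a ha =>
    obtain ⟨⟨x, y⟩, rfl⟩ := ha
    rw [Submodule.mem_torsion_iff]
    refine ⟨⟨((p * p : ℕ) : ℤ), mem_nonZeroDivisors_of_ne_zero (by positivity)⟩, ?_⟩
    have := commutatorToH1_commElt hK (hpow x) (hpow y)
    rw [commElt_pow_left hN, commElt_pow_right hN, smul_smul, map_nsmul] at this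
    change ((p * p : ℕ) : ℤ) • commutatorToH1 hK (commElt x y) = 0
    rw [natCast_zsmul]
    exact this
  | zero => rw [map_zero]; exact zero_mem _
  | add a b _ _ ha hb => rw [map_add]; exact add_mem ha hb
  | neg a _ ha => rw [map_neg]; exact neg_mem ha

/-- The map from `[N, N]` to the torsion of `H_1(K)`. -/
def commutatorToTorsion (hN : commutator N ≤ Subgroup.center N) {K : Subgroup N}
    (hK : commutator N ≤ K) {p : ℕ} (hp : p ≠ 0) (hpow : ∀ x : N, x ^ p ∈ K) :
    Additive (commutator N) →+ H1Torsion K :=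
  (commutatorToH1 hK).codRestrict (H1Torsion K).toAddSubgroup
    (commutatorToH1_mem_torsion hN hK hp hpow)

/-- If the abelianization of `N` is torsion-free, then every torsion class of `H_1(K)` comes from
`[N, N]`. -/
theorem commutatorToTorsion_surjective (hN : commutator N ≤ Subgroup.center N)
    (htf : ∀ (x : N) (n : ℕ), n ≠ 0 → x ^ n ∈ commutator N → x ∈ commutator N) {K : Subgroup N}
    (hK : commutator N ≤ K) {p : ℕ} (hp : p ≠ 0) (hpow : ∀ x : N, x ^ p ∈ K) :
    Function.Surjective (commutatorToTorsion hN hK hp hpow) := by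
  rintro ⟨z, hz⟩
  obtain ⟨⟨a, ha⟩, h⟩ := (Submodule.mem_torsion_iff _).1 hz
  change a • z = 0 at h
  have ha0 : a.natAbs ≠ 0 := Int.natAbs_ne_zero.2 (nonZeroDivisors.ne_zero ha)
  obtain ⟨k, hk⟩ : ∃ k : K, Additive.ofMul (Abelianization.of k) = z :=
    QuotientGroup.mk_surjective z.toMul
  have hz0 : a.natAbs • z = 0 := by
    rcases Int.natAbs_eq a with e | e
    · rw [e, natCast_zsmul] at h
      exact h
    · rw [e, neg_smul, natCast_zsmul, neg_eq_zero] at h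
      exact h
  have hkpow : k ^ a.natAbs ∈ commutator K := by
    rw [← hk, ← ofMul_pow, ← map_pow] at hz0
    exact (QuotientGroup.eq_one_iff _).1 (congrArg Additive.toMul hz0)
  have hkN : (k : N) ^ a.natAbs ∈ commutator N := by
    have : (commutator K).map K.subtype ≤ commutator N := by
      rw [commutator_def, Subgroup.map_commutator]
      exact Subgroup.commutator_mono le_top le_top
    exact this ⟨_, hkpow, rfl⟩
  exact ⟨.ofMul ⟨k, htf _ _ ha0 hkN⟩, Subtype.ext hk⟩

section Kernel

variable {𝔽 : Type*} [Field 𝔽]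

/-- The kernel of a homomorphism to the additive group of `𝔽`, as a subgroup of the
(multiplicative) group `N`. -/
def kerSubgroup (l : Additive N →+ 𝔽) : Subgroup N := (AddMonoidHom.toMultiplicativeRight l).ker

theorem mem_kerSubgroup {l : Additive N →+ 𝔽} {x : N} :
    x ∈ kerSubgroup l ↔ l (.ofMul x) = 0 := Iff.rfl

theorem commutator_le_kerSubgroup (l : Additive N →+ 𝔽) : commutator N ≤ kerSubgroup l :=
  fun _ => addHom_eq_zero_of_mem_commutator l

theorem pow_mem_kerSubgroup {p : ℕ} [CharP 𝔽 p] (l : Additive N →+ 𝔽) (x : N) :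
    x ^ p ∈ kerSubgroup l := by
  rw [mem_kerSubgroup, ofMul_pow, map_nsmul, nsmul_eq_mul, CharP.cast_eq_zero, zero_mul]

theorem exists_apply_eq_one {p : ℕ} [Fact p.Prime] (h𝔽 : Nat.card 𝔽 = p)
    {l : Additive N →+ 𝔽} (hl : l ≠ 0) : ∃ t : N, l (.ofMul t) = 1 := by
  obtain ⟨x, hx⟩ := DFunLike.ne_iff.1 hl
  have : (1 : 𝔽) ∈ l.range := by
    have := (AddSubgroup.eq_bot_or_eq_top_of_prime_card (l.range) (hp := ⟨by
      rw [h𝔽]; exact Fact.out⟩)).resolve_left (fun h => hx <| by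
        have : l x ∈ l.range := ⟨x, rfl⟩
        rw [h] at this
        exact this)
    rw [this]; trivial
  exact this

/-- Every element of `𝔽_p` is a natural number. -/
theorem exists_natCast_eq {p : ℕ} [Fact p.Prime] (h𝔽 : Nat.card 𝔽 = p) (a : 𝔽) :
    ∃ n : ℕ, (n : 𝔽) = a := by
  have : (AddSubgroup.zmultiples (1 : 𝔽)) = ⊤ :=
    (AddSubgroup.eq_bot_or_eq_top_of_prime_card _ (hp := ⟨by
      rw [h𝔽]; exact Fact.out⟩)).resolve_left (by simp)
  have hfin : Finite 𝔽 := Nat.finite_of_card_ne_zero (h𝔽 ▸ (Fact.out : p.Prime).ne_zero)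
  have ha : a ∈ AddSubgroup.zmultiples (1 : 𝔽) := by rw [this]; trivial
  rw [← mem_multiples_iff_mem_zmultiples] at ha
  obtain ⟨n, hn⟩ := ha
  exact ⟨n, by simpa using hn⟩

/-- The homomorphism `y ↦ φ [t, y]`. -/
def contract (hN : commutator N ≤ Subgroup.center N) (φ : Additive (commutator N) →+ 𝔽) (t : N) :
    Additive N →+ 𝔽 :=
  AddMonoidHom.mk' (fun y => φ (commElt t y.toMul)) fun x y => by
    rw [toMul_add, commElt_mul_right hN, map_add]

/-- An alternating form on `N` that vanishes on the kernel of `l` is of the form `l ∧ m`, where `m`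
is the contraction with an element `t` such that `l t = 1`. -/
theorem apply_commElt_eq_contract {p : ℕ} [Fact p.Prime] (h𝔽 : Nat.card 𝔽 = p)
    (hN : commutator N ≤ Subgroup.center N)
    (φ : Additive (commutator N) →+ 𝔽) {l : Additive N →+ 𝔽} {t : N} (ht : l (.ofMul t) = 1)
    (hφ : ∀ x ∈ kerSubgroup l, ∀ y ∈ kerSubgroup l, φ (commElt x y) = 0) (x y : N) :
    φ (commElt x y) = l (.ofMul x) * contract hN φ t (.ofMul y) -
      l (.ofMul y) * contract hN φ t (.ofMul x) := by
  have hdec (z : N) : ∃ n : ℕ, ∃ k ∈ kerSubgroup l, z = t ^ n * k ∧ l (.ofMul z) = n := by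
    obtain ⟨n, hn⟩ := exists_natCast_eq h𝔽 (l (.ofMul z))
    refine ⟨n, (t ^ n)⁻¹ * z, ?_, by simp, hn.symm⟩
    rw [mem_kerSubgroup, ofMul_mul, ofMul_inv, ofMul_pow, map_add, map_neg, map_nsmul, ht, ← hn]
    simp
  obtain ⟨i, k, hk, rfl, hik⟩ := hdec x
  obtain ⟨j, k', hk', rfl, hjk⟩ := hdec y
  rw [hik, hjk]
  have hkt : φ (commElt k t) = -φ (commElt t k) := by rw [← neg_commElt, map_neg]
  simp only [contract, AddMonoidHom.mk'_apply, toMul_ofMul, commElt_mul_left hN,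
    commElt_mul_right hN, commElt_pow_left hN, commElt_pow_right hN, map_add, map_nsmul,
    nsmul_eq_mul, commElt_self, map_zero, hφ k hk k' hk', hkt]
  ring

/-- For `K = ker l`, the classes `m` for which `l ∧ m` extends to `[N, N]` correspond to pairs of a
homomorphism `ψ` on the torsion of `H_1(K)` and a scalar `a`, via `m = ψ [t, ·] + a l`. -/
theorem card_wedgeExtends {p : ℕ} [Fact p.Prime] (h𝔽 : Nat.card 𝔽 = p) [CharP 𝔽 p]
    (hN : commutator N ≤ Subgroup.center N)
    (htf : ∀ (x : N) (n : ℕ), n ≠ 0 → x ^ n ∈ commutator N → x ∈ commutator N)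
    {l : Additive N →+ 𝔽} (hl : l ≠ 0) :
    Nat.card {m : Additive N →+ 𝔽 // WedgeExtends l m} =
      Nat.card (H1Torsion (kerSubgroup l) →+ 𝔽) * p := by
  obtain ⟨t, ht⟩ := exists_apply_eq_one h𝔽 hl
  have hp0 : p ≠ 0 := (Fact.out : p.Prime).ne_zero
  set ι := commutatorToTorsion hN (commutator_le_kerSubgroup l) hp0 (pow_mem_kerSubgroup l)
    with hι
  have hιs : Function.Surjective ι := commutatorToTorsion_surjective hN htf _ _ _
  have hιK (ψ : H1Torsion (kerSubgroup l) →+ 𝔽) (x) (hx : x ∈ kerSubgroup l)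
      (y) (hy : y ∈ kerSubgroup l) : ψ.comp ι (commElt x y) = 0 := by
    have : ι (commElt x y) = 0 := Subtype.ext (commutatorToH1_commElt _ hx hy)
    rw [AddMonoidHom.comp_apply, this, map_zero]
  have hform (ψ : H1Torsion (kerSubgroup l) →+ 𝔽) :=
    apply_commElt_eq_contract h𝔽 hN (ψ.comp ι) ht (hιK ψ)
  let Φ : (H1Torsion (kerSubgroup l) →+ 𝔽) × 𝔽 → {m : Additive N →+ 𝔽 // WedgeExtends l m} :=
    fun z => ⟨contract hN (z.1.comp ι) t + (AddMonoidHom.mulLeft z.2).comp l,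
      z.1.comp ι, fun x y => by
        rw [hform]
        simp only [AddMonoidHom.add_apply, AddMonoidHom.comp_apply, AddMonoidHom.coe_mulLeft]
        ring⟩
  have hΦt (z) : (Φ z).1 (.ofMul t) = z.2 := by
    simp [Φ, contract, commElt_self, ht]
  have hinj : Function.Injective Φ := by
    rintro ⟨ψ, a⟩ ⟨ψ', a'⟩ h
    have ha : a = a' := by
      have h1 := hΦt (ψ, a)
      rw [h, hΦt] at h1
      exact h1.symm
    subst ha
    have hc : contract hN (ψ.comp ι) t = contract hN (ψ'.comp ι) t :=
      add_right_cancel (congrArg Subtype.val h)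
    have hcomp : ψ.comp ι = ψ'.comp ι := addHom_ext_commElt fun x y => by
      rw [hform, hform, hc]
    rw [(AddMonoidHom.cancel_right hιs).1 hcomp]
  have hsurj : Function.Surjective Φ := by
    rintro ⟨m, φ, hφ⟩
    -- As `l` vanishes on `K`, the homomorphism `φ` kills `[K, K]`, so it factors through `ι`.
    have hker : ι.ker ≤ φ.ker := by
      intro z hz
      obtain ⟨z, hzN⟩ := z
      have hzK : (⟨z, commutator_le_kerSubgroup l hzN⟩ : kerSubgroup l) ∈
          commutator (kerSubgroup l) :=
        (QuotientGroup.eq_one_iff _).1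
          (congrArg (fun w : H1Torsion (kerSubgroup l) => w.1.toMul) hz)
      let S : Subgroup (kerSubgroup l) :=
        (((AddMonoidHom.toMultiplicativeRight φ).ker).map (commutator N).subtype).comap
          (kerSubgroup l).subtype
      have hS : commutator (kerSubgroup l) ≤ S := by
        rw [commutator_def, Subgroup.commutator_le]
        rintro ⟨x, hx⟩ - ⟨y, hy⟩ -
        refine ⟨(commElt x y).toMul, ?_, rfl⟩
        change φ (commElt x y) = 0
        rw [hφ, mem_kerSubgroup.1 hx, mem_kerSubgroup.1 hy, zero_mul, zero_mul, sub_zero]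
      obtain ⟨w, hw, hwz⟩ := hS hzK
      have : w = ⟨z, hzN⟩ := Subtype.ext hwz
      rw [this] at hw
      exact hw
    let ψ : H1Torsion (kerSubgroup l) →+ 𝔽 := ι.liftOfSurjective hιs ⟨φ, hker⟩
    have hψ : ψ.comp ι = φ := AddMonoidHom.ext fun z =>
      ι.liftOfRightInverse_comp_apply _ (Function.rightInverse_surjInv hιs) ⟨φ, hker⟩ z
    refine ⟨(ψ, m (.ofMul t)), Subtype.ext (AddMonoidHom.ext fun y => ?_)⟩
    change ψ.comp ι (commElt t y.toMul) + m (.ofMul t) * l y = m y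
    rw [hψ, hφ, ht, ofMul_toMul]
    ring
  rw [← Nat.card_congr (Equiv.ofBijective Φ ⟨hinj, hsurj⟩), Nat.card_prod, h𝔽]

end Kernel

end

/-! ### Presentations by commutators -/

/-- The relators of a commutator-relators group are products of commutators. -/
theorem IsCommutatorRelators.exists_presentation {G : Type*} [Group G]
    (hG : IsCommutatorRelators G) : ∃ (n : ℕ) (π : FreeGroup (Fin n) →* G),
      Function.Surjective π ∧ π.ker ≤ commutator (FreeGroup (Fin n)) := by
  obtain ⟨n, rels, -, hrels, ⟨e⟩⟩ := hG
  refine ⟨n, e.symm.toMonoidHom.comp (PresentedGroup.mk rels),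
    e.symm.surjective.comp (QuotientGroup.mk'_surjective _), fun x hx => ?_⟩
  have hx' : PresentedGroup.mk rels x = 1 := e.symm.map_eq_one_iff.1 hx
  exact Subgroup.normalClosure_le_normal hrels ((QuotientGroup.eq_one_iff x).1 hx')

theorem FreeGroup.mem_commutator_of_pow_mem {α : Type*} {x : FreeGroup α} {n : ℕ} (hn : n ≠ 0)
    (hx : x ^ n ∈ commutator (FreeGroup α)) : x ∈ commutator (FreeGroup α) := by
  refine (QuotientGroup.eq_one_iff x).1 ?_
  let a : FreeAbelianGroup α := Additive.ofMul (Abelianization.of x)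
  have ha : n • a = 0 := by
    have : Abelianization.of (x ^ n) = 1 := (QuotientGroup.eq_one_iff _).2 hx
    rw [map_pow] at this
    exact this
  have h0 : n • FreeAbelianGroup.equivFinsupp α a = 0 := by rw [← map_nsmul, ha, map_zero]
  have : FreeAbelianGroup.equivFinsupp α a = 0 := (smul_eq_zero.1 h0).resolve_left hn
  exact (FreeAbelianGroup.equivFinsupp α).map_eq_zero_iff.1 this

theorem commutator_le_center_secondNilpotentQuotient (G : Type*) [Group G] :
    commutator (SecondNilpotentQuotient G) ≤ Subgroup.center (SecondNilpotentQuotient G) := by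
  rw [commutator_def, Subgroup.commutator_le]
  intro x _ y _
  induction x using QuotientGroup.induction_on with | _ x
  induction y using QuotientGroup.induction_on with | _ y
  rw [Subgroup.mem_center_iff]
  intro z
  induction z using QuotientGroup.induction_on with | _ z
  refine (QuotientGroup.eq.2 ?_ : ((z * ⁅x, y⁆ : G) : SecondNilpotentQuotient G) =
    ((⁅x, y⁆ * z : G) : SecondNilpotentQuotient G))
  have h : (z * ⁅x, y⁆)⁻¹ * (⁅x, y⁆ * z) = ⁅(⁅x, y⁆)⁻¹, z⁻¹⁆ := by
    simp only [commutatorElement_def]; group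
  rw [h, Subgroup.lowerCentralSeries_succ, Subgroup.top_lowerCentralSeries_one]
  exact Subgroup.commutator_mem_commutator
    (inv_mem (Subgroup.commutator_mem_commutator (Subgroup.mem_top x) (Subgroup.mem_top y)))
    (Subgroup.mem_top _)

theorem comap_commutator_of_ker_le {A B : Type*} [Group A] [Group B] {f : A →* B}
    (hf : Function.Surjective f) (hker : f.ker ≤ commutator A) :
    (commutator B).comap f = commutator A := by
  have : commutator B = (commutator A).map f := by
    rw [commutator_def, commutator_def, Subgroup.map_commutator,
      Subgroup.map_top_of_surjective f hf]
  rw [this, Subgroup.comap_map_eq, sup_eq_left.2 hker]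

/-- The abelianization of `G/G_3` is torsion-free, since it is that of the free group. -/
theorem mem_commutator_of_pow_mem_secondNilpotentQuotient {α G : Type*} [Group G]
    (π : FreeGroup α →* G) (hπ : Function.Surjective π)
    (hker : π.ker ≤ commutator (FreeGroup α)) (x : SecondNilpotentQuotient G) (n : ℕ)
    (hn : n ≠ 0) (hx : x ^ n ∈ commutator (SecondNilpotentQuotient G)) :
    x ∈ commutator (SecondNilpotentQuotient G) := by
  have h1 := comap_commutator_of_ker_le
    (QuotientGroup.mk'_surjective ((⊤ : Subgroup G).lowerCentralSeries 2))
    (by rw [QuotientGroup.ker_mk']; exact lowerCentralSeries_two_le_commutator G)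
  have h2 := comap_commutator_of_ker_le hπ hker
  obtain ⟨g, rfl⟩ := QuotientGroup.mk'_surjective _ x
  obtain ⟨f, rfl⟩ := hπ g
  rw [← map_pow, ← Subgroup.mem_comap, h1, ← map_pow, ← Subgroup.mem_comap, h2] at hx
  rw [← Subgroup.mem_comap, h1, ← Subgroup.mem_comap, h2]
  exact FreeGroup.mem_commutator_of_pow_mem hn hx

/-! ### Counting homomorphisms to the prime field -/

/-- The dimension of `T ⊗ ℤ/p` is read off from the number of homomorphisms from `T` to `ℤ/p`. -/
theorem rank_zmod_tensor_eq_iff {p : ℕ} [Fact p.Prime] {𝔽 : Type*} [Field 𝔽]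
    (h𝔽 : Nat.card 𝔽 = p) (T : Type*) [AddCommGroup T] (d : ℕ) :
    Module.rank (ZMod p) (TensorProduct ℤ (ZMod p) T) = d ↔ Nat.card (T →+ 𝔽) = p ^ d := by
  have hp : p.Prime := Fact.out
  have hfin : Finite 𝔽 := Nat.finite_of_card_ne_zero (h𝔽 ▸ hp.ne_zero)
  have := Fintype.ofFinite 𝔽
  let e : ZMod p ≃+* 𝔽 := ZMod.ringEquivOfPrime 𝔽 hp (by rw [← Nat.card_eq_fintype_card, h𝔽])
  let E : Module.Dual (ZMod p) (TensorProduct ℤ (ZMod p) T) ≃ (T →+ 𝔽) :=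
    (LinearMap.liftBaseChangeEquiv (ZMod p)).symm.toEquiv.trans
      ((addMonoidHomLequivInt (A := T) (B := ZMod p) ℤ).symm.toEquiv.trans
        (e.toAddEquiv.addMonoidHomCongrRightEquiv))
  rw [← Nat.card_congr E]
  have hcard [Module.Finite (ZMod p) (TensorProduct ℤ (ZMod p) T)] :
      Nat.card (Module.Dual (ZMod p) (TensorProduct ℤ (ZMod p) T)) =
        p ^ Module.finrank (ZMod p) (TensorProduct ℤ (ZMod p) T) := by
    rw [Module.natCard_eq_pow_finrank (K := ZMod p), Nat.card_zmod, Subspace.dual_finrank_eq]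
  constructor
  · intro h
    have : Module.Finite (ZMod p) (TensorProduct ℤ (ZMod p) T) :=
      Module.rank_lt_aleph0_iff.1 (h ▸ Cardinal.natCast_lt_aleph0)
    rw [hcard, Module.finrank_eq_of_rank_eq h]
  · intro h
    have : Finite (Module.Dual (ZMod p) (TensorProduct ℤ (ZMod p) T)) :=
      Nat.finite_of_card_ne_zero (h ▸ pow_ne_zero _ hp.ne_zero)
    have : Module.Finite (ZMod p) (TensorProduct ℤ (ZMod p) T) :=
      (Module.finite_dual_iff (ZMod p)).1 inferInstance
    rw [hcard] at h
    rw [← Module.finrank_eq_rank, Nat.pow_right_injective hp.two_le h]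

/-! ### Subgroups of index `p` and lines of homomorphisms -/

section

variable {N 𝔽 : Type*} [Group N] [Field 𝔽] {p : ℕ} [Fact p.Prime]

instance kerSubgroup_normal (l : Additive N →+ 𝔽) : (kerSubgroup l).Normal :=
  MonoidHom.normal_ker _

theorem index_kerSubgroup (h𝔽 : Nat.card 𝔽 = p) {l : Additive N →+ 𝔽} (hl : l ≠ 0) :
    (kerSubgroup l).index = p := by
  have hs : Function.Surjective (AddMonoidHom.toMultiplicativeRight l) := by
    obtain ⟨t, ht⟩ := exists_apply_eq_one h𝔽 hl
    intro a
    obtain ⟨n, hn⟩ := exists_natCast_eq h𝔽 a.toAdd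
    refine ⟨t ^ n, ?_⟩
    change l (.ofMul (t ^ n)) = a.toAdd
    rw [ofMul_pow, map_nsmul, ht, nsmul_one, hn]
  rw [kerSubgroup, Subgroup.index_ker, MonoidHom.range_eq_top.2 hs, Subgroup.card_top]
  exact h𝔽

theorem kerSubgroup_smul {a : 𝔽} (ha : a ≠ 0) (l : Additive N →+ 𝔽) :
    kerSubgroup (a • l) = kerSubgroup l := by
  ext x
  rw [mem_kerSubgroup, mem_kerSubgroup, AddMonoidHom.smul_apply, smul_eq_zero_iff_right ha]

theorem exists_smul_eq_of_kerSubgroup_eq (h𝔽 : Nat.card 𝔽 = p) {l m : Additive N →+ 𝔽}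
    (hl : l ≠ 0) (h : kerSubgroup l = kerSubgroup m) : ∃ a : 𝔽, a • l = m := by
  obtain ⟨t, ht⟩ := exists_apply_eq_one h𝔽 hl
  refine ⟨m (.ofMul t), AddMonoidHom.ext fun x => ?_⟩
  obtain ⟨n, hn⟩ := exists_natCast_eq h𝔽 (l x)
  have hx : (t ^ n)⁻¹ * x.toMul ∈ kerSubgroup l := by
    rw [mem_kerSubgroup, ofMul_mul, ofMul_inv, ofMul_pow, map_add, map_neg, map_nsmul, ht,
      ofMul_toMul, ← hn]
    simp
  rw [h, mem_kerSubgroup, ofMul_mul, ofMul_inv, ofMul_pow, map_add, map_neg, map_nsmul, ofMul_toMul,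
    neg_add_eq_zero, nsmul_eq_mul] at hx
  rw [AddMonoidHom.smul_apply, smul_eq_mul, ← hn, mul_comm, hx]

theorem exists_kerSubgroup_eq (h𝔽 : Nat.card 𝔽 = p) {K : Subgroup N} [K.Normal]
    (hK : K.index = p) : ∃ l : Additive N →+ 𝔽, l ≠ 0 ∧ kerSubgroup l = K := by
  have e : N ⧸ K ≃* Multiplicative 𝔽 := mulEquivOfPrimeCardEq (p := p) hK h𝔽
  let l : Additive N →+ 𝔽 := AddMonoidHom.toMultiplicativeRight.symm
    (e.toMonoidHom.comp (QuotientGroup.mk' K))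
  have hl : kerSubgroup l = K := by
    ext x
    exact e.map_eq_one_iff.trans (QuotientGroup.eq_one_iff x)
  refine ⟨l, ?_, hl⟩
  rintro h0
  have : K = ⊤ := by
    rw [← hl, h0]
    exact eq_top_iff.2 fun _ _ => rfl
  rw [this, Subgroup.index_top] at hK
  exact (Fact.out : p.Prime).ne_one hK.symm

end

/-! ### Cohomology classes as homomorphisms -/

section

variable (G : Type u) [Group G] (𝔽 : Type u) [Field 𝔽]

/-- Inflation identifies the homomorphisms on `G/G_3` with those on `G`. -/
def inflateEquiv : (Additive (SecondNilpotentQuotient G) →+ 𝔽) ≃ₗ[𝔽] (Additive G →+ 𝔽) :=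
  LinearEquiv.ofBijective
    { toFun := inflate, map_add' := fun _ _ => rfl, map_smul' := fun _ _ => rfl } <| by
    constructor
    · intro l m h
      refine AddMonoidHom.ext fun x => ?_
      obtain ⟨g, hg⟩ := QuotientGroup.mk'_surjective _ x.toMul
      have : x = .ofMul (g : SecondNilpotentQuotient G) := congrArg Additive.ofMul hg.symm
      rw [this]
      exact DFunLike.congr_fun h (Additive.ofMul g)
    · intro l
      refine ⟨AddMonoidHom.toMultiplicativeRight.symm
        (QuotientGroup.lift _ (AddMonoidHom.toMultiplicativeRight l)
          ((lowerCentralSeries_two_le_commutator G).trans (commutator_le_kerSubgroup l))), ?_⟩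
      ext x
      rfl

/-- Classes in `H^1(G, 𝔽)` are the homomorphisms from `G/G_3` to `𝔽`. -/
def h1Equiv : Cohomology G 𝔽 1 ≃ₗ[𝔽] (Additive (SecondNilpotentQuotient G) →+ 𝔽) :=
  (groupCohomology.H1IsoOfIsTrivial (Rep.trivial 𝔽 G 𝔽)).toLinearEquiv.trans
    (inflateEquiv G 𝔽).symm

variable {G 𝔽}

theorem inflate_h1Equiv_apply (a : Cohomology G 𝔽 1) (x : G) :
    inflate (h1Equiv G 𝔽 a) (.ofMul x) = (h1ToCocycles G 𝔽 a : G → 𝔽) x := by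
  have : inflate (h1Equiv G 𝔽 a) =
      (groupCohomology.H1IsoOfIsTrivial (Rep.trivial 𝔽 G 𝔽)).toLinearEquiv a :=
    (inflateEquiv G 𝔽).apply_symm_apply _
  rw [this]
  rfl

theorem cupProduct_eq_zero_iff_boundsCup (a b : Cohomology G 𝔽 1) :
    cupProduct G 𝔽 a b = 0 ↔
      ∃ c, BoundsCup (inflate (h1Equiv G 𝔽 a)) (inflate (h1Equiv G 𝔽 b)) c := by
  have h0 : cupProduct G 𝔽 a b = (groupCohomology.H2π (Rep.trivial 𝔽 G 𝔽)).hom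
    (cupCocycle (h1ToCocycles G 𝔽 a) (h1ToCocycles G 𝔽 b)) := rfl
  have h1 := groupCohomology.H2π_eq_zero_iff
    (cupCocycle (h1ToCocycles G 𝔽 a) (h1ToCocycles G 𝔽 b))
  rw [h0]
  refine h1.trans ?_
  constructor
  · rintro ⟨c, hc⟩
    refine ⟨c, fun x y => ?_⟩
    have h2 : (c y : 𝔽) - c (x * y) + c x =
      (h1ToCocycles G 𝔽 a : G → 𝔽) x * (h1ToCocycles G 𝔽 b : G → 𝔽) y := congrFun hc (x, y)
    rw [inflate_h1Equiv_apply, inflate_h1Equiv_apply]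
    linear_combination -h2
  · rintro ⟨c, hc⟩
    refine ⟨c, funext fun z => ?_⟩
    have h2 := hc z.1 z.2
    rw [inflate_h1Equiv_apply, inflate_h1Equiv_apply] at h2
    change (c z.2 : 𝔽) - c (z.1 * z.2) + c z.1 =
      (h1ToCocycles G 𝔽 a : G → 𝔽) z.1 * (h1ToCocycles G 𝔽 b : G → 𝔽) z.2
    linear_combination -h2

theorem mem_resonanceVariety_iff [FiniteDimensional 𝔽 (Cohomology G 𝔽 1)]
    (d : ℕ) (a : Cohomology G 𝔽 1) :
    a ∈ resonanceVariety G 𝔽 d ↔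
      d + 1 ≤ Module.finrank 𝔽 (LinearMap.ker (cupProduct G 𝔽 a)) := by
  constructor
  · rintro ⟨W, hW, h⟩
    rw [← hW]
    exact Submodule.finrank_mono fun w hw => h w hw
  · intro h
    obtain ⟨f, hf⟩ := exists_linearIndependent_of_le_finrank h
    have hf' := hf.map' (LinearMap.ker (cupProduct G 𝔽 a)).subtype (Submodule.ker_subtype _)
    refine ⟨_, (finrank_span_eq_card hf').trans (Fintype.card_fin _), fun w hw => ?_⟩
    have : Submodule.span 𝔽 (Set.range
        ((LinearMap.ker (cupProduct G 𝔽 a)).subtype ∘ f)) ≤ LinearMap.ker (cupProduct G 𝔽 a) := by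
      rw [Submodule.span_le]
      rintro _ ⟨i, rfl⟩
      exact (f i).2
    exact this hw

theorem finite_cohomology_one [Finite 𝔽] {n : ℕ} (π : FreeGroup (Fin n) →* G)
    (hπ : Function.Surjective π) : Finite (Cohomology G 𝔽 1) := by
  have : Finite (Additive G →+ 𝔽) := by
    refine Finite.of_injective
      (fun (l : Additive G →+ 𝔽) (i : Fin n) => l (.ofMul (π (.of i)))) fun l m h => ?_
    have : (AddMonoidHom.toMultiplicativeRight l).comp π =
        (AddMonoidHom.toMultiplicativeRight m).comp π :=
      FreeGroup.ext_hom _ _ fun i => congrFun h i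
    ext x
    obtain ⟨f, rfl⟩ := hπ x
    exact DFunLike.congr_fun this f
  exact Finite.of_equiv _
    (groupCohomology.H1IsoOfIsTrivial (Rep.trivial 𝔽 G 𝔽)).toLinearEquiv.toEquiv.symm

end

/-- The kernel of a nonzero class in `H^1(G, 𝔽)` has torsion of rank `d` in its first homology if and
only if the class lies in `R_d` but not in `R_{d+1}`. -/
theorem kerSubgroup_mem_nuSet_iff {G : Type u} [Group G] {n : ℕ} (π : FreeGroup (Fin n) →* G)
    (hπ : Function.Surjective π) (hker : π.ker ≤ commutator (FreeGroup (Fin n)))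
    {p : ℕ} [Fact p.Prime] {𝔽 : Type u} [Field 𝔽] (h𝔽 : Nat.card 𝔽 = p) (d : ℕ)
    {a : Cohomology G 𝔽 1} (ha : a ≠ 0) :
    kerSubgroup (h1Equiv G 𝔽 a) ∈ nuSet (SecondNilpotentQuotient G) p d ↔
      a ∈ resonanceVariety G 𝔽 d \ resonanceVariety G 𝔽 (d + 1) := by
  have hp : p.Prime := Fact.out
  have hfin : Finite 𝔽 := Nat.finite_of_card_ne_zero (h𝔽 ▸ hp.ne_zero)
  have := Fintype.ofFinite 𝔽
  have : CharP 𝔽 p := charP_of_card_eq_prime (by rw [← h𝔽, Nat.card_eq_fintype_card])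
  have hH : Finite (Cohomology G 𝔽 1) := finite_cohomology_one π hπ
  have hl : h1Equiv G 𝔽 a ≠ 0 := (h1Equiv G 𝔽).map_ne_zero_iff.2 ha
  have hZ : Nat.card (LinearMap.ker (cupProduct G 𝔽 a)) =
      Nat.card {m // WedgeExtends (h1Equiv G 𝔽 a) m} :=
    Nat.card_congr ((h1Equiv G 𝔽).toEquiv.subtypeEquiv fun b => by
      rw [LinearMap.mem_ker, cupProduct_eq_zero_iff_boundsCup,
        exists_boundsCup_inflate_iff π hπ hker]
      rfl)
  rw [card_wedgeExtends h𝔽 (commutator_le_center_secondNilpotentQuotient G)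
    (mem_commutator_of_pow_mem_secondNilpotentQuotient π hπ hker) hl,
    Module.natCard_eq_pow_finrank (K := 𝔽), h𝔽] at hZ
  have hnu : kerSubgroup (h1Equiv G 𝔽 a) ∈ nuSet (SecondNilpotentQuotient G) p d ↔
      Nat.card (H1Torsion (kerSubgroup (h1Equiv G 𝔽 a)) →+ 𝔽) = p ^ d :=
    ⟨fun h => (rank_zmod_tensor_eq_iff h𝔽 _ d).1 h.2.2, fun h =>
      ⟨inferInstance, index_kerSubgroup h𝔽 hl, (rank_zmod_tensor_eq_iff h𝔽 _ d).2 h⟩⟩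
  rw [hnu, Set.mem_sdiff, mem_resonanceVariety_iff, mem_resonanceVariety_iff,
    ← mul_left_inj' hp.ne_zero, ← hZ, ← pow_succ, (Nat.pow_right_injective hp.two_le).eq_iff]
  omega

theorem mainTheorem1 {G : Type u} [Group G] (hG : IsCommutatorRelators G)
    (hH₂ : IsAddTorsionFree (IntegralHomology G 2))
    (p : ℕ) (hp : p.Prime) (𝔽 : Type u) [Field 𝔽] (h𝔽 : Nat.card 𝔽 = p) (d : ℕ) :
    (nuSet (SecondNilpotentQuotient G) p d).Finite ∧
      (projResonanceVariety G 𝔽 d \ projResonanceVariety G 𝔽 (d + 1)).Finite ∧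
      nu (SecondNilpotentQuotient G) p d =
        (projResonanceVariety G 𝔽 d \ projResonanceVariety G 𝔽 (d + 1)).ncard := by
  obtain ⟨n, π, hπ, hker⟩ := hG.exists_presentation
  have : Fact p.Prime := ⟨hp⟩
  have hfin : Finite 𝔽 := Nat.finite_of_card_ne_zero (h𝔽 ▸ hp.ne_zero)
  have hH : Finite (Cohomology G 𝔽 1) := finite_cohomology_one π hπ
  have hfinP : (projResonanceVariety G 𝔽 d \ projResonanceVariety G 𝔽 (d + 1)).Finite :=
    Set.toFinite _
  let κ : Projectivization 𝔽 (Cohomology G 𝔽 1) → Subgroup (SecondNilpotentQuotient G) :=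
    fun x => kerSubgroup (h1Equiv G 𝔽 x.rep)
  have hκinj : Function.Injective κ := by
    intro x y hxy
    obtain ⟨a, ha⟩ := exists_smul_eq_of_kerSubgroup_eq h𝔽
      ((h1Equiv G 𝔽).map_ne_zero_iff.2 x.rep_nonzero) hxy
    rw [← map_smul, (h1Equiv G 𝔽).injective.eq_iff] at ha
    rw [← x.mk_rep, ← y.mk_rep, eq_comm, Projectivization.mk_eq_mk_iff']
    exact ⟨a, ha⟩
  have hκ (x) : κ x ∈ nuSet (SecondNilpotentQuotient G) p d ↔
      x ∈ projResonanceVariety G 𝔽 d \ projResonanceVariety G 𝔽 (d + 1) := by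
    rw [kerSubgroup_mem_nuSet_iff π hπ hker h𝔽 d x.rep_nonzero, Set.mem_sdiff, Set.mem_sdiff,
      ← mk_mem_projResonanceVariety G 𝔽 d _ x.rep_nonzero,
      ← mk_mem_projResonanceVariety G 𝔽 (d + 1) _ x.rep_nonzero, x.mk_rep]
  have himage : κ '' (projResonanceVariety G 𝔽 d \ projResonanceVariety G 𝔽 (d + 1)) =
      nuSet (SecondNilpotentQuotient G) p d := by
    apply Set.Subset.antisymm
    · rintro _ ⟨x, hx, rfl⟩
      exact (hκ x).2 hx
    · intro K hK
      have : K.Normal := hK.1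
      obtain ⟨l, hl, rfl⟩ := exists_kerSubgroup_eq (𝔽 := 𝔽) h𝔽 hK.2.1
      have ha : (h1Equiv G 𝔽).symm l ≠ 0 := (h1Equiv G 𝔽).symm.map_ne_zero_iff.2 hl
      obtain ⟨c, hc⟩ := Projectivization.exists_smul_eq_mk_rep 𝔽 _ ha
      have hκl : κ (Projectivization.mk 𝔽 _ ha) = kerSubgroup l := by
        change kerSubgroup (h1Equiv G 𝔽 (Projectivization.mk 𝔽 _ ha).rep) = _
        rw [← hc, Units.smul_def, map_smul, LinearEquiv.apply_symm_apply,
          kerSubgroup_smul c.ne_zero]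
      exact ⟨_, (hκ _).1 (hκl ▸ hK), hκl⟩
  refine ⟨himage ▸ hfinP.image κ, hfinP, ?_⟩
  rw [nu, ← himage, hκinj.injOn.ncard_image]

end
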